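/- All rings are commutative with $1$. An extension $R\subseteq S$ is called Prüfer if $R\subseteq T$ is a flat epimorphism of rings for every intermediate ring $R\subseteq T\subseteq S$, and quasi-Prüfer if there is an intermediate ring $R'$ such that $R\subseteq R'$ is integral and $R'\subseteq S$ is Prüfer. An element $s\in S$ is called primitive over $R$ if $p(s)=0$ for some polynomial $p\in R[X]$ whose coefficients generate the unit ideal of $R$; let $\mathcal P_S(R)$ be the set of all these elements. Let $R\subseteq S$ be any ring extension and let $\overline R$ be the integral closure of $R$ in $S$. Then: 1. There is a greatest intermediate ring $T$ of $\overline R\subseteq S$ such that $\overline R\subseteq T$ is Prüfer (the Prüfer hull of $\overline R$ in $S$). 2. There is a greatest intermediate ring $T$ of $R\subseteq S$ such that $R\subseteq T$ is quasi-Prüfer (the quasi-Prüfer hull of $R$ in $S$), and it is equal to the Prüfer hull of $\overline R$ in $S$. 3. $\mathcal P_S(R)$ is a subring of $S$ if and only if $\mathcal P_S(R)$ is equal to the quasi-Prüfer hull of $R$ in $S$. -/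

import Mathlib

/-- For a ring extension `R ⊆ S`, given by an algebra with injective structure map: `R ⊆ S` is
Prüfer if `R ⊆ T` is a flat epimorphism of rings for every intermediate ring `T`. -/
def IsPruferExtension (R S : Type*) [CommRing R] [CommRing S] [Algebra R S] : Prop :=
  ∀ T : Subalgebra R S, Module.Flat R T ∧ Algebra.IsEpi R T

/-- `R ⊆ S` is quasi-Prüfer if it factors as `R ⊆ R' ⊆ S` with `R ⊆ R'` integral and `R' ⊆ S`
Prüfer. -/
def IsQuasiPruferExtension (R S : Type*) [CommRing R] [CommRing S] [Algebra R S] : Prop :=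
  ∃ R' : Subalgebra R S, Algebra.IsIntegral R R' ∧ IsPruferExtension R' S

/-- The Prüfer hull of `R` in `S`: the supremum of all intermediate rings `T` with `R ⊆ T` Prüfer.
It is meant to be the greatest such `T`; that it is one of them is not part of the definition. -/
def pruferHull (R S : Type*) [CommRing R] [CommRing S] [Algebra R S] : Subalgebra R S :=
  sSup {T : Subalgebra R S | IsPruferExtension R T}

/-- The quasi-Prüfer hull of `R` in `S`: the supremum of all intermediate rings `T` with `R ⊆ T`
quasi-Prüfer. It is meant to be the greatest such `T`; that it is one of them is not part of the
definition. -/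
def quasiPruferHull (R S : Type*) [CommRing R] [CommRing S] [Algebra R S] : Subalgebra R S :=
  sSup {T : Subalgebra R S | IsQuasiPruferExtension R T}

/-- `s` is primitive over `R` if it is a root of a polynomial over `R` whose coefficients generate
the unit ideal of `R`. -/
def IsPrimitiveOver (R : Type*) {S : Type*} [CommRing R] [CommRing S] [Algebra R S] (s : S) :
    Prop :=
  ∃ p : Polynomial R, p.contentIdeal = ⊤ ∧ Polynomial.aeval s p = 0

/-- The set of elements of `S` that are primitive over `R`. -/
def primitiveElements (R S : Type*) [CommRing R] [CommRing S] [Algebra R S] : Set S :=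
  {s : S | IsPrimitiveOver R s}

/-! Everything is tested prime by prime. By `isPruferExtension_iff`, Prüfer means that every element
is valuative at every prime of the base. If so, common denominators of finitely many elements
generate the unit ideal upstairs, which yields flatness and epimorphy. Conversely, in a Prüfer
extension all intermediate rings are integrally closed, so `s` lies in `R[s ^ 2]` and is locally
primitive; over an integrally closed base, locally primitive implies valuative.

Valuative subextensions are comparable locally, so Prüfer subextensions are directed and their union
is the hull. Elements integral over a Prüfer extension are locally primitive, hence valuative over
the integral closure; this bounds quasi-Prüfer subextensions. Primitivity descends along integral
extensions, so the hull always consists of primitive elements. Conversely, a ring of primitive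
elements contains the integral closure and is Prüfer over it. -/

open Polynomial TensorProduct

/-- `s` satisfies a linear equation `x s = y` over `R` with `x` or `y` outside `m`. If `m` is prime
and `R ⊆ S`, this says that locally at `m` either `s` or its inverse lies in `R`. -/
def IsValuativeAt {R S : Type*} [CommRing R] [CommRing S] [Algebra R S] (m : Ideal R) (s : S) :
    Prop :=
  ∃ x y : R, algebraMap R S x * s = algebraMap R S y ∧ (x ∉ m ∨ y ∉ m)

/-- `s` is a root of a polynomial over `R` with a coefficient outside `m`. -/
def IsPrimitiveAt {R S : Type*} [CommRing R] [CommRing S] [Algebra R S] (m : Ideal R) (s : S) :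
    Prop :=
  ∃ p : R[X], aeval s p = 0 ∧ ∃ k, p.coeff k ∉ m

/-- The ideal of all `x : R` with `x t ∈ R`. -/
def denominatorIdeal (R : Type*) {T : Type*} [CommRing R] [CommRing T] [Algebra R T] (t : T) :
    Ideal R :=
  (LinearMap.range (Algebra.linearMap R T)).comap (LinearMap.toSpanSingleton R T t)

/-! ### Valuative elements, denominators and flat epimorphisms -/

section Local

variable {R S : Type*} [CommRing R] [CommRing S] [Algebra R S]

theorem mem_denominatorIdeal {t : S} {x : R} :
    x ∈ denominatorIdeal R t ↔ ∃ y, algebraMap R S x * t = algebraMap R S y := by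
  simp [denominatorIdeal, Algebra.smul_def, eq_comm]

/-- Finitely many valuative elements, together with `1`, become a unimodular row over the
localization after multiplication with a suitable ring element. -/
theorem IsValuativeAt.exists_common_denominator {m : Ideal R} [hm : m.IsPrime]
    (h : ∀ s : S, IsValuativeAt m s) (F : Finset S) :
    ∃ x : R, (∀ s ∈ F, x ∈ denominatorIdeal R s) ∧
      ∃ s : S, (s = 1 ∨ s ∈ F) ∧ ∃ y ∉ m, algebraMap R S x * s = algebraMap R S y := by
  classical
  induction F using Finset.induction_on with
  | empty => exact ⟨1, by simp, 1, Or.inl rfl, 1, m.one_notMem, by simp⟩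
  | insert a F _ ih =>
    obtain ⟨x, hx, s, hs, r, hr, hxs⟩ := ih
    -- If `y ∉ m`, the old witness `s` survives scaling by `y`; otherwise `a` is the new one.
    obtain ⟨y, z, hyz, hm'⟩ := h (algebraMap R S x * a)
    refine ⟨y * x, fun t ht ↦ ?_, ?_⟩
    · obtain rfl | ht := Finset.mem_insert.mp ht
      · exact mem_denominatorIdeal.mpr ⟨z, by rw [map_mul, mul_assoc, hyz]⟩
      · exact Ideal.mul_mem_left _ _ (hx t ht)
    · rcases hm' with hy | hz
      · refine ⟨s, hs.imp_right (Finset.mem_insert_of_mem ·), y * r, ?_, ?_⟩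
        · exact fun h' ↦ (hm.mem_or_mem h').elim hy hr
        · rw [map_mul, mul_assoc, hxs, map_mul]
      · exact ⟨a, Or.inr (Finset.mem_insert_self _ _), z, hz, by rw [map_mul, mul_assoc, hyz]⟩

/-- The common denominators of finitely many elements generate the unit ideal. -/
theorem map_iInf_denominatorIdeal_eq_top
    (h : ∀ (m : Ideal R) [m.IsPrime] (s : S), IsValuativeAt m s) (F : Finset S) :
    Ideal.map (algebraMap R S) (⨅ s ∈ F, denominatorIdeal R s) = ⊤ := by
  by_contra hne
  obtain ⟨M, hM, hle⟩ := Ideal.exists_le_maximal _ hne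
  obtain ⟨x, hx, s, -, y, hy, hxs⟩ :=
    IsValuativeAt.exists_common_denominator (h (M.comap (algebraMap R S))) F
  refine hy ?_
  have hxM : algebraMap R S x ∈ M :=
    hle (Ideal.mem_map_of_mem _ (by simpa only [Submodule.mem_iInf] using hx))
  rw [Ideal.mem_comap, ← hxs]
  exact M.mul_mem_right _ hxM

theorem exists_sum_eq_one_of_map_eq_top {I : Ideal R} (h : Ideal.map (algebraMap R S) I = ⊤) :
    ∃ (k : ℕ) (x : Fin k → R) (u : Fin k → S), (∀ j, x j ∈ I) ∧ ∑ j, x j • u j = 1 := by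
  have h1 : (1 : S) ∈ Submodule.span S (algebraMap R S '' I) := by
    change (1 : S) ∈ Ideal.map (algebraMap R S) I
    rw [h]; trivial
  obtain ⟨k, f, g, hfg⟩ := Submodule.mem_span_set'.mp h1
  choose x hx hxg using fun j ↦ (g j).2
  exact ⟨k, x, f, hx, by simp [← hfg, Algebra.smul_def, hxg, mul_comm]⟩

/-- Equational criterion: if `1 = ∑ x j • u j` with common denominators `x j`, then `t i = ∑ (x j *
t i) * u j` has its coefficients `x j * t i` in `R`. -/
theorem Module.Flat.of_isValuativeAt (hinj : Function.Injective (algebraMap R S))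
    (h : ∀ (m : Ideal R) [m.IsPrime] (s : S), IsValuativeAt m s) : Module.Flat R S := by
  classical
  refine Module.Flat.of_forall_isTrivialRelation fun {l f t} hft ↦ ?_
  obtain ⟨k, x, u, hx, hsum⟩ := exists_sum_eq_one_of_map_eq_top
    (map_iInf_denominatorIdeal_eq_top h (Finset.univ.image t))
  have hx' (i : Fin l) (j : Fin k) : x j ∈ denominatorIdeal R (t i) := by
    have := hx j
    simp only [Submodule.mem_iInf] at this
    exact this _ (Finset.mem_image_of_mem _ (Finset.mem_univ i))
  choose a ha using fun i j ↦ mem_denominatorIdeal.mp (hx' i j)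
  refine ⟨k, a, u, fun i ↦ ?_, fun j ↦ hinj ?_⟩
  · rw [← mul_one (t i), ← hsum, Finset.mul_sum]
    refine Finset.sum_congr rfl fun j _ ↦ ?_
    rw [Algebra.smul_def, Algebra.smul_def, ← ha]
    ring
  · simp only [map_sum, map_mul, map_zero, ← ha]
    calc ∑ i, algebraMap R S (f i) * (algebraMap R S (x j) * t i)
        = algebraMap R S (x j) * ∑ i, f i • t i := by
          rw [Finset.mul_sum]
          exact Finset.sum_congr rfl fun i _ ↦ by rw [Algebra.smul_def]; ring
      _ = 0 := by rw [hft, mul_zero]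

theorem Algebra.IsEpi.of_isValuativeAt
    (h : ∀ (m : Ideal R) [m.IsPrime] (s : S), IsValuativeAt m s) : Algebra.IsEpi R S := by
  refine (Algebra.isEpi_iff_forall_one_tmul_eq R S).mpr fun t ↦ ?_
  obtain ⟨k, x, u, hx, hsum⟩ := exists_sum_eq_one_of_map_eq_top
    (map_iInf_denominatorIdeal_eq_top h {t})
  have hx' (j : Fin k) : x j ∈ denominatorIdeal R t := by simpa using hx j
  choose a ha using fun j ↦ mem_denominatorIdeal.mp (hx' j)
  have h1 (j : Fin k) : (1 : S) ⊗ₜ[R] (t * x j • u j) = t ⊗ₜ[R] (x j • u j) := by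
    have e1 : t * x j • u j = a j • u j := by
      rw [Algebra.smul_def, Algebra.smul_def, ← ha]; ring
    have e2 : x j • t = a j • (1 : S) := by
      rw [Algebra.smul_def, ha, Algebra.algebraMap_eq_smul_one]
    rw [e1, ← smul_tmul, ← smul_tmul, e2]
  calc (1 : S) ⊗ₜ[R] t = ∑ j, (1 : S) ⊗ₜ[R] (t * x j • u j) := by
        rw [← tmul_sum, ← Finset.mul_sum, hsum, mul_one]
    _ = ∑ j, t ⊗ₜ[R] (x j • u j) := Finset.sum_congr rfl fun j _ ↦ h1 j
    _ = t ⊗ₜ[R] 1 := by rw [← tmul_sum, hsum]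

/-- In a flat epimorphic extension, the denominators of any element generate the unit ideal. -/
theorem map_denominatorIdeal_eq_top [Module.Flat R S] [Algebra.IsEpi R S] (t : S) :
    Ideal.map (algebraMap R S) (denominatorIdeal R t) = ⊤ := by
  set N := LinearMap.range (Algebra.linearMap R S)
  let g : R →ₗ[R] S ⧸ N := N.mkQ ∘ₗ LinearMap.toSpanSingleton R S t
  have hg : denominatorIdeal R t = LinearMap.ker g := by
    rw [LinearMap.ker_comp, Submodule.ker_mkQ]; rfl
  -- This embedding stays injective after tensoring with `S`, by flatness, while `S ⊗ (S ⧸ N)`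
  -- vanishes by epimorphy.
  let f : (R ⧸ denominatorIdeal R t) →ₗ[R] S ⧸ N := (denominatorIdeal R t).liftQ g hg.le
  have hf : Function.Injective f := by
    rw [← LinearMap.ker_eq_bot]
    exact Submodule.ker_liftQ_eq_bot _ _ _ hg.ge
  have hzero (z : S ⊗[R] (S ⧸ N)) : z = 0 := by
    induction z using TensorProduct.induction_on with
    | zero => rfl
    | add _ _ h₁ h₂ => rw [h₁, h₂, add_zero]
    | tmul a b =>
      obtain ⟨b, rfl⟩ := N.mkQ_surjective b
      have hab : a ⊗ₜ[R] b = (a * b) ⊗ₜ[R] (1 : S) := by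
        apply Algebra.IsEpi.injective_lift_mul (R := R)
        simp
      have := congr(N.mkQ.lTensor S $hab)
      rw [LinearMap.lTensor_tmul, LinearMap.lTensor_tmul] at this
      rw [this, (Submodule.mkQ_apply N 1).trans ((Submodule.Quotient.mk_eq_zero N).mpr ⟨1, by simp⟩),
        tmul_zero]
  have hsub : Subsingleton (S ⊗[R] (R ⧸ denominatorIdeal R t)) :=
    ⟨fun a b ↦ Module.Flat.lTensor_preserves_injective_linearMap (M := S) f hf
      ((hzero _).trans (hzero _).symm)⟩
  have hsub' := (tensorQuotEquivQuotSMul S (denominatorIdeal R t)).symm.injective.subsingleton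
  rw [Submodule.Quotient.subsingleton_iff, Ideal.smul_top_eq_map] at hsub'
  exact (Submodule.restrictScalars_eq_top_iff R S S).mp hsub'

end Local

/-! ### Locally primitive elements -/

section Primitive

variable {R S : Type*} [CommRing R] [CommRing S] [Algebra R S]

theorem IsValuativeAt.isPrimitiveAt {m : Ideal R} {s : S} (h : IsValuativeAt m s) :
    IsPrimitiveAt m s := by
  obtain ⟨x, y, hxy, hm⟩ := h
  refine ⟨C x * X - C y, by simp [hxy], ?_⟩
  rcases hm with hx | hy
  · exact ⟨1, by simpa [coeff_C] using hx⟩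
  · exact ⟨0, by simpa using hy⟩

theorem isValuativeAt_algebraMap {m : Ideal R} [m.IsPrime] (r : R) :
    IsValuativeAt m (algebraMap R S r) :=
  ⟨1, r, by simp, Or.inl m.one_notMem⟩

theorem IsIntegral.isPrimitiveAt {m : Ideal R} [m.IsPrime] {s : S} (h : IsIntegral R s) :
    IsPrimitiveAt m s := by
  obtain ⟨p, hp, hps⟩ := h
  refine ⟨p, hps, p.natDegree, ?_⟩
  rw [hp.coeff_natDegree]
  exact m.one_notMem

theorem IsPrimitiveAt.map {R₁ : Type*} [CommRing R₁] [Algebra R₁ S] (φ : R →+* R₁)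
    (hφ : (algebraMap R₁ S).comp φ = algebraMap R S) {m : Ideal R₁} {s : S}
    (h : IsPrimitiveAt (m.comap φ) s) : IsPrimitiveAt m s := by
  obtain ⟨p, hp, k, hk⟩ := h
  refine ⟨p.map φ, ?_, k, by simpa using hk⟩
  rwa [aeval_def, eval₂_map, hφ]

/-- If `R` is integrally closed in `S`, then locally primitive elements are locally valuative. -/
theorem IsPrimitiveAt.isValuativeAt (hinj : Function.Injective (algebraMap R S))
    (hcl : ∀ s : S, IsIntegral R s → ∃ r, algebraMap R S r = s) {m : Ideal R} {s : S}
    (h : IsPrimitiveAt m s) : IsValuativeAt m s := by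
  obtain ⟨p, hp, k, hk⟩ := h
  induction hn : p.natDegree using Nat.strong_induction_on generalizing p k with
  | _ n ih =>
  subst hn
  obtain ⟨c, hc⟩ := hcl _ (isIntegral_leadingCoeff_smul p s hp)
  rw [Algebra.smul_def] at hc
  by_cases ha : p.leadingCoeff ∈ m
  swap
  · exact ⟨_, c, hc.symm, Or.inl ha⟩
  by_cases hcm : c ∈ m
  swap
  · exact ⟨_, c, hc.symm, Or.inr hcm⟩
  have hpos : 0 < p.natDegree := by
    refine Nat.pos_of_ne_zero fun h0 ↦ hk ?_
    rw [eq_C_of_natDegree_eq_zero h0, aeval_C, ← map_zero (algebraMap R S)] at hp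
    rw [eq_C_of_natDegree_eq_zero h0, hinj hp]
    simp
  obtain ⟨n, hn⟩ : ∃ n, p.natDegree = n + 1 := ⟨_, (Nat.succ_pred_eq_of_pos hpos).symm⟩
  have hsplit : p = p.eraseLead + C p.leadingCoeff * X ^ (n + 1) := by
    rw [← hn, eraseLead_add_C_mul_X_pow]
  -- As the leading coefficient times `s` is `c`, the leading term can be traded for `c * X ^ n`.
  -- Modulo `m` no coefficient changes.
  refine ih (p.eraseLead + C c * X ^ n).natDegree ?_ (p.eraseLead + C c * X ^ n) ?_ k ?_ rfl
  · have h1 := p.eraseLead_natDegree_le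
    have h2 := natDegree_C_mul_X_pow_le c n
    have h3 := natDegree_add_le p.eraseLead (C c * X ^ n)
    have h4 : max p.eraseLead.natDegree (C c * X ^ n).natDegree ≤ n := max_le (by omega) h2
    omega
  · rw [hsplit] at hp
    rw [map_add, map_mul, aeval_C, map_pow, aeval_X] at hp ⊢
    rw [hc, mul_assoc, ← pow_succ']
    exact hp
  · intro hmem
    refine hk ?_
    rw [coeff_add, coeff_C_mul] at hmem
    rw [hsplit, coeff_add, coeff_C_mul]
    exact m.add_mem ((m.add_mem_iff_left (m.mul_mem_right _ hcm)).mp hmem) (m.mul_mem_right _ ha)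

/-- Being primitive is a local condition on the base ring. -/
theorem isPrimitiveOver_iff {s : S} :
    IsPrimitiveOver R s ↔ ∀ (m : Ideal R) [m.IsPrime], IsPrimitiveAt m s := by
  constructor
  · rintro ⟨p, hp, hps⟩ m hm
    refine ⟨p, hps, ?_⟩
    by_contra! hall
    refine hm.ne_top (top_le_iff.mp ?_)
    rw [← hp, contentIdeal_def, Ideal.span_le]
    intro c hc
    obtain ⟨k, -, rfl⟩ := mem_coeffs_iff.mp hc
    exact hall k
  · intro h
    let I : Ideal R :=
      { carrier := {c | ∃ p : R[X], aeval s p = 0 ∧ c ∈ p.contentIdeal}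
        zero_mem' := ⟨0, by simp, by simp⟩
        smul_mem' := fun r c ⟨p, hp, hc⟩ ↦ ⟨p, hp, Ideal.mul_mem_left _ r hc⟩
        add_mem' := by
          rintro a b ⟨p, hp, ha⟩ ⟨q, hq, hb⟩
          -- The shift keeps the coefficients of `p` and `q` from overlapping.
          refine ⟨p + X ^ (p.natDegree + 1) * q, by simp [hp, hq], add_mem ?_ ?_⟩
          · revert ha
            apply SetLike.le_def.mp
            rw [contentIdeal_def, Ideal.span_le]
            intro c hc
            obtain ⟨k, hk, rfl⟩ := mem_coeffs_iff.mp hc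
            have hk' := le_natDegree_of_mem_supp k hk
            have := coeff_mem_contentIdeal (p := p + X ^ (p.natDegree + 1) * q) k
            rwa [coeff_add, coeff_X_pow_mul', if_neg (by omega), add_zero] at this
          · revert hb
            apply SetLike.le_def.mp
            rw [contentIdeal_def, Ideal.span_le]
            intro c hc
            obtain ⟨k, hk, rfl⟩ := mem_coeffs_iff.mp hc
            have := coeff_mem_contentIdeal (p := p + X ^ (p.natDegree + 1) * q)
              (k + (p.natDegree + 1))
            rwa [coeff_add, coeff_X_pow_mul, coeff_eq_zero_of_natDegree_lt (by omega),
              zero_add] at this }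
    have hI : I = ⊤ := by
      by_contra hne
      obtain ⟨m, hm, hle⟩ := Ideal.exists_le_maximal I hne
      obtain ⟨p, hp, k, hk⟩ := h m
      exact hk (hle ⟨p, hp, p.coeff_mem_contentIdeal k⟩)
    obtain ⟨p, hp, h1⟩ := (Ideal.eq_top_iff_one I).mp hI
    exact ⟨p, (Ideal.eq_top_iff_one _).mpr h1, hp⟩

/-- An element integral over an extension `T` of `R` all of whose elements are locally valuative
is locally primitive over `R`. -/
theorem IsIntegral.isPrimitiveAt_of_isValuativeAt {T : Type*} [CommRing T] [Algebra R T]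
    [Algebra T S] [IsScalarTower R T S] (hinj : Function.Injective (algebraMap R T))
    {m : Ideal R} [m.IsPrime] (h : ∀ t : T, IsValuativeAt m t) {s : S} (hs : IsIntegral T s) :
    IsPrimitiveAt m s := by
  classical
  obtain ⟨p, hp, hps⟩ := hs
  obtain ⟨x, hx, t, ht, y, hy, hxt⟩ :=
    IsValuativeAt.exists_common_denominator h (insert 0 p.coeffs)
  have hcoeff (k : ℕ) : p.coeff k ∈ insert 0 p.coeffs := by
    by_cases hk : p.coeff k = 0
    · simp [hk]
    · exact Finset.mem_insert_of_mem (coeff_mem_coeffs hk)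
  have hlift : C (algebraMap R T x) * p ∈ lifts (algebraMap R T) := by
    rw [lifts_iff_coeff_lifts]
    intro k
    obtain ⟨r, hr⟩ := mem_denominatorIdeal.mp (hx _ (hcoeff k))
    exact ⟨r, by rw [coeff_C_mul, hr]⟩
  obtain ⟨q, hq⟩ := (mem_lifts _).mp hlift
  have hqk (k : ℕ) : algebraMap R T (q.coeff k) = algebraMap R T x * p.coeff k := by
    rw [← coeff_map, hq, coeff_C_mul]
  refine ⟨q, ?_, ?_⟩
  · rw [← aeval_map_algebraMap T, hq, map_mul, aeval_def (p := p), hps, mul_zero]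
  -- `1` is the leading coefficient of the monic `p`, and `0` is a coefficient beyond its degree.
  · obtain ⟨k, rfl⟩ : ∃ k, p.coeff k = t := by
      rcases ht with rfl | ht
      · exact ⟨_, hp.coeff_natDegree⟩
      · rcases Finset.mem_insert.mp ht with rfl | ht
        · exact ⟨p.natDegree + 1, coeff_eq_zero_of_natDegree_lt (by omega)⟩
        · obtain ⟨k, -, hk⟩ := mem_coeffs_iff.mp ht
          exact ⟨k, hk.symm⟩
    refine ⟨k, ?_⟩
    rwa [hinj ((hqk k).trans hxt)]

attribute [local instance] Polynomial.algebra in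
/-- An element primitive over an integral extension of `R` is primitive over `R`. -/
theorem IsPrimitiveAt.of_isIntegral {R₁ : Type*} [CommRing R₁] [Algebra R R₁] [Algebra R₁ S]
    [IsScalarTower R R₁ S] [Algebra.IsIntegral R R₁] {s : S}
    (h : ∀ (n : Ideal R₁) [n.IsPrime], IsPrimitiveAt n s) (m : Ideal R) [m.IsPrime] :
    IsPrimitiveAt m s := by
  by_contra hnot
  have hall (p : R[X]) (hp : aeval s p = 0) (k : ℕ) : p.coeff k ∈ m := by
    by_contra hk
    exact hnot ⟨p, hp, k, hk⟩
  have hmap (p : R[X]) : algebraMap R[X] R₁[X] p = p.map (algebraMap R R₁) := rfl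
  have : (m.map (C : R →+* R[X])).IsPrime := Ideal.isPrime_map_C_of_isPrime
  -- Going up in the integral extension `R[X] → R₁[X]`: the polynomials over `R` killing `s` lie in
  -- `m R[X]`.
  obtain ⟨Q, hKQ, hQ, hQm⟩ := Ideal.exists_ideal_over_prime_of_isIntegral
    (m.map (C : R →+* R[X])) (RingHom.ker (aeval s : R₁[X] →ₐ[R₁] S).toRingHom) <| by
      intro p hp
      rw [Ideal.mem_comap, hmap] at hp
      refine Ideal.mem_map_C_iff.mpr (hall p ?_)
      rw [← aeval_map_algebraMap R₁]
      exact hp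
  set n : Ideal R₁ := Q.comap C
  have hn : (n.map (C : R₁ →+* R₁[X])).IsPrime := Ideal.isPrime_map_C_of_isPrime
  have hle : n.map C ≤ Q := Ideal.map_comap_le
  -- Incomparability forces `Q = n R₁[X]`, so no polynomial over `R₁` killing `s` has a coefficient
  -- outside `n`.
  have hQn : Q ≤ n.map C := by
    by_contra hlt
    have := Ideal.IsIntegral.comap_lt_comap (R := R[X]) (lt_of_le_not_ge hle hlt)
    rw [hQm] at this
    refine this.not_ge fun p hp ↦ ?_
    rw [Ideal.mem_comap, hmap, Ideal.mem_map_C_iff]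
    intro k
    have h1 : (C (p.coeff k) : R[X]) ∈ Q.comap (algebraMap R[X] R₁[X]) := by
      rw [hQm]
      exact Ideal.mem_map_of_mem _ (Ideal.mem_map_C_iff.mp hp k)
    rw [Ideal.mem_comap, hmap, map_C] at h1
    rw [coeff_map]
    exact h1
  obtain ⟨p, hp, k, hk⟩ := h n
  exact hk (Ideal.mem_map_C_iff.mp (hQn (hKQ hp)) k)

end Primitive

/-! ### Prüfer extensions and the Prüfer hull -/

section Prufer

variable {R S : Type*} [CommRing R] [CommRing S] [Algebra R S]

/-- If `R ⊆ S` is Prüfer, then every intermediate ring is integrally closed in `S`. -/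
theorem IsPruferExtension.mem_of_isIntegral (h : IsPruferExtension R S) (A : Subalgebra R S)
    {s : S} (hs : IsIntegral A s) : s ∈ A := by
  let T : Subalgebra A S := Algebra.adjoin A {s}
  obtain ⟨hflat, hepi⟩ := h (T.restrictScalars R)
  let t : T := ⟨s, Algebra.self_mem_adjoin_singleton A s⟩
  have htop : Ideal.map (algebraMap R (T.restrictScalars R))
      (denominatorIdeal R (T := T.restrictScalars R) t) = ⊤ := map_denominatorIdeal_eq_top _
  have htop' : Ideal.map (algebraMap A T) (denominatorIdeal A t) = ⊤ := by
    refine top_le_iff.mp (htop.ge.trans (Ideal.map_le_iff_le_comap.mpr fun x hx ↦ ?_))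
    obtain ⟨y, hy⟩ := mem_denominatorIdeal.mp hx
    exact Ideal.mem_map_of_mem (algebraMap A T) (x := algebraMap R A x)
      (mem_denominatorIdeal.mpr ⟨algebraMap R A y, hy⟩)
  have hint : (algebraMap A T).IsIntegral := by
    have : Algebra.IsIntegral A T := Algebra.IsIntegral.adjoin (by simpa using hs)
    exact fun x ↦ Algebra.IsIntegral.isIntegral (R := A) x
  have hinj : Function.Injective (algebraMap A T) := fun a b hab ↦
    Subtype.ext (congrArg (fun z : T ↦ (z : S)) hab)
  -- A proper ideal stays proper in an integral extension, so `1` is a denominator of `s`.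
  rw [Ideal.map_eq_top_iff _ hinj hint, Ideal.eq_top_iff_one, mem_denominatorIdeal] at htop'
  obtain ⟨y, hy⟩ := htop'
  have hys : s = y := by simpa [t] using congrArg (fun z : T ↦ (z : S)) hy
  exact hys ▸ y.2

/-- Being integral over `R[s ^ 2]`, `s` equals some `q(s ^ 2)`; then `X - q(X ^ 2)` has linear
coefficient `1`. -/
theorem IsPruferExtension.isPrimitiveAt (h : IsPruferExtension R S) {m : Ideal R} [m.IsPrime]
    (s : S) : IsPrimitiveAt m s := by
  have hs : s ∈ Algebra.adjoin R {s ^ 2} :=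
    h.mem_of_isIntegral _ <| IsIntegral.of_pow two_pos <|
      isIntegral_algebraMap (A := S)
        (x := (⟨s ^ 2, Algebra.self_mem_adjoin_singleton R _⟩ : Algebra.adjoin R {s ^ 2}))
  rw [Algebra.adjoin_singleton_eq_range_aeval] at hs
  obtain ⟨q, hq⟩ := hs
  refine ⟨X - expand R 2 q, ?_, 1, ?_⟩
  · rw [map_sub, aeval_X, expand_aeval]
    exact sub_eq_zero.mpr hq.symm
  · rw [coeff_sub, coeff_X_one, coeff_expand two_pos, if_neg (by decide), sub_zero]
    exact m.one_notMem

theorem isValuativeAt_coe {T : Subalgebra R S} {m : Ideal R} {t : T} :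
    IsValuativeAt m (t : S) ↔ IsValuativeAt m t := by
  refine exists₂_congr fun x y ↦ and_congr_left fun _ ↦ ?_
  rw [Subtype.ext_iff]
  rfl

/-- An extension is Prüfer if and only if each of its elements is locally valuative. -/
theorem isPruferExtension_iff (hinj : Function.Injective (algebraMap R S)) :
    IsPruferExtension R S ↔ ∀ (m : Ideal R) [m.IsPrime] (s : S), IsValuativeAt m s := by
  refine ⟨fun h m _ s ↦ (h.isPrimitiveAt s).isValuativeAt hinj fun s hs ↦ ?_, fun h T ↦ ?_⟩
  · exact h.mem_of_isIntegral ⊥ hs.tower_top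
  · have hT (m : Ideal R) [m.IsPrime] (t : T) : IsValuativeAt m t := isValuativeAt_coe.mp (h m _)
    exact ⟨Module.Flat.of_isValuativeAt
      (fun a b hab ↦ hinj (congrArg (fun z : T ↦ (z : S)) hab)) hT,
      Algebra.IsEpi.of_isValuativeAt hT⟩

theorem Subalgebra.isPruferExtension_iff (hinj : Function.Injective (algebraMap R S))
    (T : Subalgebra R S) :
    IsPruferExtension R T ↔ ∀ (m : Ideal R) [m.IsPrime], ∀ s ∈ T, IsValuativeAt m s := by
  rw [_root_.isPruferExtension_iff fun a b hab ↦ hinj (congrArg (fun z : T ↦ (z : S)) hab)]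
  exact ⟨fun h m _ s hs ↦ isValuativeAt_coe.mpr (h m ⟨s, hs⟩),
    fun h m _ t ↦ isValuativeAt_coe.mp (h m t t.2)⟩

/-- The elements that lie in `A` locally at `m`. -/
def Subalgebra.localSaturation (A : Subalgebra R S) (m : Ideal R) [hm : m.IsPrime] :
    Subalgebra R S where
  carrier := {s | ∃ u ∉ m, algebraMap R S u * s ∈ A}
  algebraMap_mem' r := ⟨1, m.one_notMem, by simp⟩
  mul_mem' := by
    rintro a b ⟨u, hu, ha⟩ ⟨v, hv, hb⟩
    refine ⟨u * v, fun h ↦ (hm.mem_or_mem h).elim hu hv, ?_⟩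
    rw [map_mul, mul_mul_mul_comm]
    exact A.mul_mem ha hb
  add_mem' := by
    rintro a b ⟨u, hu, ha⟩ ⟨v, hv, hb⟩
    refine ⟨u * v, fun h ↦ (hm.mem_or_mem h).elim hu hv, ?_⟩
    have : algebraMap R S (u * v) * (a + b) = algebraMap R S v * (algebraMap R S u * a) +
        algebraMap R S u * (algebraMap R S v * b) := by
      rw [map_mul]; ring
    rw [this]
    exact A.add_mem (A.mul_mem (A.algebraMap_mem v) ha) (A.mul_mem (A.algebraMap_mem u) hb)

theorem Subalgebra.le_localSaturation (A : Subalgebra R S) (m : Ideal R) [m.IsPrime] :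
    A ≤ A.localSaturation m :=
  fun s hs ↦ ⟨1, m.one_notMem, by simpa using hs⟩

theorem IsValuativeAt.of_mul {m : Ideal R} [hm : m.IsPrime] {u : R} (hu : u ∉ m) {s : S}
    (h : IsValuativeAt m (algebraMap R S u * s)) : IsValuativeAt m s := by
  obtain ⟨x, y, hxy, hxm⟩ := h
  refine ⟨x * u, y, by rw [map_mul, mul_assoc, hxy], ?_⟩
  exact hxm.imp_left fun hx h ↦ (hm.mem_or_mem h).elim hx hu

/-- Two Prüfer extensions of `R` in `S` are comparable locally at each prime ideal. -/
theorem le_localSaturation_or_le {A B : Subalgebra R S} (m : Ideal R) [hm : m.IsPrime]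
    (hA : ∀ s ∈ A, IsValuativeAt m s) (hB : ∀ s ∈ B, IsValuativeAt m s) :
    A ≤ B.localSaturation m ∨ B ≤ A.localSaturation m := by
  have hmul {u v : R} (hu : u ∉ m) (hv : v ∉ m) : u * v ∉ m :=
    fun h ↦ (hm.mem_or_mem h).elim hu hv
  refine or_iff_not_imp_left.mpr fun hAB b hb ↦ ?_
  obtain ⟨a, ha, haB⟩ := SetLike.not_le_iff_exists.mp hAB
  obtain ⟨x, u, hxu, hx⟩ := hA a ha
  by_cases hxm : x ∈ m
  swap
  · exact (haB ⟨x, hxm, hxu ▸ B.algebraMap_mem u⟩).elim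
  obtain ⟨y, v, hyv, hy⟩ := hB b hb
  by_cases hym : y ∈ m
  swap
  · exact ⟨y, hym, hyv ▸ A.algebraMap_mem v⟩
  have hv := hy.resolve_left (not_not.mpr hym)
  -- Since `y * b = v` with `v ∉ m`, the element `y * a` acts as the quotient of `a` by `b`, up to a
  -- local unit.
  obtain ⟨z, w, hzw, hzw'⟩ := hA (algebraMap R S y * a) (A.mul_mem (A.algebraMap_mem y) ha)
  have key : algebraMap R S (z * v) * a = algebraMap R S w * b := by
    rw [map_mul, ← hyv, ← hzw]; ring
  rcases hzw' with hz | hw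
  · exact (haB ⟨z * v, hmul hz hv, key ▸ B.mul_mem (B.algebraMap_mem w) hb⟩).elim
  · exact ⟨w, hw, key ▸ A.mul_mem (A.algebraMap_mem _) ha⟩

/-- At each prime, `A ⊔ B` lies in the local saturation of `A` or of `B`. -/
theorem IsPruferExtension.sup (hinj : Function.Injective (algebraMap R S))
    {A B : Subalgebra R S} (hA : IsPruferExtension R A) (hB : IsPruferExtension R B) :
    IsPruferExtension R ↥(A ⊔ B) := by
  rw [Subalgebra.isPruferExtension_iff hinj] at hA hB ⊢
  intro m _ s hs
  rcases le_localSaturation_or_le m (hA m) (hB m) with h | h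
  · obtain ⟨u, hu, hus⟩ := sup_le h (B.le_localSaturation m) hs
    exact (hB m _ hus).of_mul hu
  · obtain ⟨u, hu, hus⟩ := sup_le (A.le_localSaturation m) h hs
    exact (hA m _ hus).of_mul hu

/-- The Prüfer hull is the greatest Prüfer subextension. -/
theorem isGreatest_pruferHull (hinj : Function.Injective (algebraMap R S)) :
    IsGreatest {T : Subalgebra R S | IsPruferExtension R T} (pruferHull R S) := by
  refine ⟨?_, fun T hT ↦ le_sSup hT⟩
  have hne : {T : Subalgebra R S | IsPruferExtension R T}.Nonempty := by
    refine ⟨⊥, (Subalgebra.isPruferExtension_iff hinj _).mpr fun m _ s hs ↦ ?_⟩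
    obtain ⟨r, rfl⟩ := Algebra.mem_bot.mp hs
    exact isValuativeAt_algebraMap r
  have hdir : DirectedOn (· ≤ ·) {T : Subalgebra R S | IsPruferExtension R T} :=
    fun A hA B hB ↦ ⟨A ⊔ B, IsPruferExtension.sup hinj hA hB, le_sup_left, le_sup_right⟩
  refine (Subalgebra.isPruferExtension_iff hinj _).mpr fun m _ s hs ↦ ?_
  have := hne.to_subtype
  rw [pruferHull, sSup_eq_iSup', ← SetLike.mem_coe,
    Subalgebra.coe_iSup_of_directed hdir.directed_val, Set.mem_iUnion] at hs
  obtain ⟨⟨T, hT⟩, hsT⟩ := hs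
  exact (Subalgebra.isPruferExtension_iff hinj T).mp hT m s hsT

end Prufer

/-! ### The quasi-Prüfer hull and primitive elements -/

section Hull

variable {R S : Type*} [CommRing R] [CommRing S] [Algebra R S]

theorem isValuativeAt_integralClosure_of_isPrimitiveAt {m : Ideal (integralClosure R S)} {s : S}
    (h : IsPrimitiveAt m s) : IsValuativeAt m s :=
  h.isValuativeAt Subtype.val_injective fun s hs ↦
    ⟨⟨s, isIntegral_trans (R := R) s hs⟩, rfl⟩

theorem Subalgebra.mem_pruferHull_of_isPrimitiveAt (C : Subalgebra (integralClosure R S) S)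
    (h : ∀ s ∈ C, ∀ (m : Ideal (integralClosure R S)) [m.IsPrime], IsPrimitiveAt m s) :
    C ≤ pruferHull (integralClosure R S) S :=
  (isGreatest_pruferHull Subtype.val_injective).2 <|
    (C.isPruferExtension_iff Subtype.val_injective).mpr fun m _ s hs ↦
      isValuativeAt_integralClosure_of_isPrimitiveAt (h s hs m)

/-- Every quasi-Prüfer subextension is contained in the Prüfer hull of the integral closure. -/
theorem IsQuasiPruferExtension.le_pruferHull {T : Subalgebra R S}
    (hT : IsQuasiPruferExtension R T) :
    T ≤ (pruferHull (integralClosure R S) S).restrictScalars R := by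
  obtain ⟨R', hint, hP⟩ := hT
  rw [isPruferExtension_iff Subtype.val_injective] at hP
  let φ : R' →+* integralClosure R S := (algebraMap R' S).codRestrict (integralClosure R S)
    fun r ↦ ((hint.isIntegral r).map R'.val).map T.val
  -- `T` need not contain the integral closure; adjoining it keeps everything integral over `T`.
  let C : Subalgebra (integralClosure R S) S := Algebra.adjoin _ (T : Set S)
  have hC (s : S) (hs : s ∈ C) : IsIntegral T s := by
    induction hs using Algebra.adjoin_induction with
    | mem s hs => exact isIntegral_algebraMap (A := S) (x := (⟨s, hs⟩ : T))
    | algebraMap b => exact IsIntegral.tower_top (A := T) b.2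
    | add _ _ _ _ h₁ h₂ => exact h₁.add h₂
    | mul _ _ _ _ h₁ h₂ => exact h₁.mul h₂
  have hle : C ≤ pruferHull (integralClosure R S) S := by
    refine C.mem_pruferHull_of_isPrimitiveAt fun s hs m _ ↦ ?_
    refine IsPrimitiveAt.map φ rfl ?_
    exact (hC s hs).isPrimitiveAt_of_isValuativeAt (T := T) Subtype.val_injective (hP _)
  exact fun s hs ↦ hle (Algebra.subset_adjoin hs)

/-- The hull contains the integral closure of `R` in `S`, whose elements remain integral inside it;
linear equations carry over along `φ`. -/
theorem isQuasiPruferExtension_pruferHull_integralClosure :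
    IsQuasiPruferExtension R ↥((pruferHull (integralClosure R S) S).restrictScalars R) := by
  set H := pruferHull (integralClosure R S) S
  let H' := H.restrictScalars R
  refine ⟨integralClosure R H', inferInstance, ?_⟩
  have hH : IsPruferExtension (integralClosure R S) H :=
    (isGreatest_pruferHull Subtype.val_injective).1
  rw [isPruferExtension_iff (R := integralClosure R S) (S := H) fun a b hab ↦
    Subtype.ext (congrArg (fun z : H ↦ (z : S)) hab)] at hH
  refine (isPruferExtension_iff (R := integralClosure R H') (S := H')
    Subtype.val_injective).mpr fun m _ s ↦ ?_
  have hmem (b : integralClosure R S) :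
      (algebraMap (integralClosure R S) H b : H') ∈ integralClosure R H' :=
    (isIntegral_algHom_iff H'.val Subtype.val_injective).mp b.2
  let φ : integralClosure R S →+* integralClosure R H' :=
    (algebraMap (integralClosure R S) H).codRestrict (integralClosure R H') hmem
  obtain ⟨x, y, hxy, hxm⟩ := hH (m.comap φ) s
  exact ⟨φ x, φ y, hxy, hxm⟩

theorem isGreatest_pruferHull_integralClosure :
    IsGreatest {T : Subalgebra R S | IsQuasiPruferExtension R T}
      ((pruferHull (integralClosure R S) S).restrictScalars R) :=
  ⟨isQuasiPruferExtension_pruferHull_integralClosure, fun _ hT ↦ hT.le_pruferHull⟩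

theorem quasiPruferHull_eq :
    quasiPruferHull R S = (pruferHull (integralClosure R S) S).restrictScalars R :=
  isGreatest_pruferHull_integralClosure.isLUB.sSup_eq

theorem isPrimitiveOver_of_mem_pruferHull {s : S}
    (hs : s ∈ pruferHull (integralClosure R S) S) : IsPrimitiveOver R s := by
  have hH := (Subalgebra.isPruferExtension_iff Subtype.val_injective _).mp
    (isGreatest_pruferHull (R := integralClosure R S) (S := S) Subtype.val_injective).1
  exact isPrimitiveOver_iff.mpr fun m _ ↦
    IsPrimitiveAt.of_isIntegral (fun n _ ↦ (hH n s hs).isPrimitiveAt) m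

/-- If the primitive elements form a subring, then they lie in the Prüfer hull of the integral
closure. -/
theorem mem_pruferHull_of_isPrimitiveOver {A : Subring S}
    (hA : (A : Set S) = primitiveElements R S) {s : S} (hs : IsPrimitiveOver R s) :
    s ∈ pruferHull (integralClosure R S) S := by
  have hmem (s : S) : s ∈ A ↔ IsPrimitiveOver R s := Set.ext_iff.mp hA s
  let C : Subalgebra (integralClosure R S) S :=
    { A.toSubsemiring with
      algebraMap_mem' := fun b ↦ (hmem _).mpr <| isPrimitiveOver_iff.mpr fun _ _ ↦
        IsIntegral.isPrimitiveAt b.2 }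
  refine C.mem_pruferHull_of_isPrimitiveAt (fun t ht m _ ↦ ?_) ((hmem s).mpr hs)
  exact IsPrimitiveAt.map (algebraMap R (integralClosure R S)) rfl
    (isPrimitiveOver_iff.mp ((hmem t).mp ht) _)

end Hull

theorem mainTheorem12 {R S : Type*} [CommRing R] [CommRing S] [Algebra R S]
    (hRS : Function.Injective (algebraMap R S)) :
    -- the two hulls exist: they are greatest subextensions of the respective kind
    IsGreatest {T : Subalgebra (integralClosure R S) S |
        IsPruferExtension (integralClosure R S) T} (pruferHull (integralClosure R S) S) ∧
    IsGreatest {T : Subalgebra R S | IsQuasiPruferExtension R T} (quasiPruferHull R S) ∧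
    -- the quasi-Prüfer hull of `R` is the Prüfer hull of the integral closure of `R` in `S`
    quasiPruferHull R S = (pruferHull (integralClosure R S) S).restrictScalars R ∧
    -- the primitive elements form a subring of `S` iff they are the quasi-Prüfer hull
    ((∃ A : Subring S, (A : Set S) = primitiveElements R S) ↔
      primitiveElements R S = (quasiPruferHull R S : Set S)) := by
  refine ⟨isGreatest_pruferHull Subtype.val_injective, ?_, quasiPruferHull_eq, ?_, ?_⟩
  · rw [quasiPruferHull_eq]
    exact isGreatest_pruferHull_integralClosure
  · rintro ⟨A, hA⟩
    rw [quasiPruferHull_eq]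
    exact Set.Subset.antisymm (fun s hs ↦ mem_pruferHull_of_isPrimitiveOver hA hs)
      fun s hs ↦ isPrimitiveOver_of_mem_pruferHull hs
  · exact fun h ↦ ⟨(quasiPruferHull R S).toSubring, h.symm⟩
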